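/- Let $k$ be a field, $n\ge 0$, and let $\xi_0,\xi_1$ be finite multisets of elements of $\mathbb N^n$, where $\mathbb N^n$ is ordered componentwise. For a field $K\supseteq k$ and a finite multiset $\xi$ in $\mathbb N^n$ let $F_K(\xi)=\bigoplus_{e\in\xi}K[x_1,\dots,x_n]\,e$ be the free $\mathbb N^n$-graded $K[x_1,\dots,x_n]$-module with one basis element of degree $v$ for each occurrence of $v$ in $\xi$; its piece $F_K(\xi)_v$ of degree $v$ has dimension $\#\{e\in\xi : \deg e\le v\}$. A relation family over $K$ is a collection $(V_v)_{v\in\xi_1}$, one space for each distinct degree $v$ occurring in $\xi_1$, of $K$-subspaces $V_v\subseteq F_K(\xi_0)_v$ with $\dim V_v=\dim F_K(\xi_1)_v$ and $x^{v-u}V_u\subseteq V_v$ whenever $u\le v$ in $\xi_1$. Let $\mathcal{RF}_K(\xi_0,\xi_1)$ be the set of these, let $\mathcal G_K=\prod_{v\in\xi_1}\mathrm{Gr}_{\dim F_K(\xi_1)_v}(F_K(\xi_0)_v)$ be the product of the Grassmannians of subspaces (one factor for each distinct $v$), let $j_K:\mathcal{RF}_K(\xi_0,\xi_1)\to\mathcal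 G_K$ be the map $(V_v)_v\mapsto (V_v)_v$, and let $\pi_K$ be the product of the Plücker maps, from $\mathcal G_K$ to a product of projective spaces over $K$ with homogeneous coordinates the Plücker coordinates (maximal minors) with respect to the monomial bases of the spaces $F_K(\xi_0)_v$. Then: 1. $j_k$ is injective. 2. The image of $j_k$ is the set of all $(P_v)_v\in\mathcal G_k$ with $x^{v-u}P_u\subseteq P_v$ for all $u\le v$ in $\xi_1$. 3. There is a set $S$ of multihomogeneous polynomials with coefficients in $k$ in the Plücker coordinates of the factors such that, for every extension field $K$ of $k$ (in particular for $K=k$): $\pi_K$ is injective; the image of $j_K$ is the set of all points of $\mathcal G_K$ at which all polynomials of $S$ vanish; and the image of $\pi_K\circ j_K$ is the set of all points of the product of projective spaces at which all polynomials of $S$ vanish. So $j$ identifies $\mathcal{RF}(\xi_0,\xi_1)$ with a Zariski closed subset, defined over $k$, of the product of Grassmannians, which is also closed in the product of projective spaces; this gives it the structure of a (possibly reducible or empty) projective variety. -/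

import Mathlib

open MvPolynomial Module LinearAlgebra.Projectivization

universe u

/-! ### Free `n`-graded modules over `A_n = K[x_1, …, x_n]`

A (finite) multiset `ξ` of degrees in `ℕ^n` is coerced to the type of its elements `(v, i)`,
where `i` runs over the copies of `v`; `e.1` is the degree of the element `e`. -/

/-- The free `n`-graded module `F(ξ) = ⨁_{(v,i) ∈ ξ} K[x_1, …, x_n](v)`. -/
abbrev FreeGraded (K : Type*) [Field K] {n : ℕ} (ξ : Multiset (Fin n →₀ ℕ)) : Type _ :=
  ξ →₀ MvPolynomial (Fin n) K

/-- The homogeneous piece `F(ξ)_v`: on the basis element `e` only the monomial `x^d` with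
`deg e + d = v` may occur (so nothing at all unless `deg e ≤ v`). -/
def gradedPiece (K : Type*) [Field K] {n : ℕ} (ξ : Multiset (Fin n →₀ ℕ)) (v : Fin n →₀ ℕ) :
    Submodule K (FreeGraded K ξ) where
  carrier := {f | ∀ (e : ξ) (d : Fin n →₀ ℕ), coeff d (f e) ≠ 0 → e.1 + d = v}
  zero_mem' := by intro e d h; simp at h
  add_mem' := by
    intro f g hf hg e d h
    by_contra hne
    have h1 : coeff d (f e) = 0 := by_contra fun h' => hne (hf e d h')
    have h2 : coeff d (g e) = 0 := by_contra fun h' => hne (hg e d h')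
    simp [h1, h2] at h
  smul_mem' := by
    intro c f hf e d h
    refine hf e d fun h' => h ?_
    simp [h']

/-- The number `#{(u,i) ∈ ξ | u ≤ v}`; by `finrank_gradedPiece` it is the dimension of `F(ξ)_v`. -/
noncomputable def pieceDim {n : ℕ} (ξ : Multiset (Fin n →₀ ℕ)) (v : Fin n →₀ ℕ) : ℕ :=
  Nat.card {e : ξ // e.1 ≤ v}

/-- Coordinates on `F(ξ)_v`: the coordinate of `f` at `e` is the coefficient of `x^(v - deg e)`
in the `e`-th component of `f`. -/
noncomputable def pieceEquiv (K : Type*) [Field K] {n : ℕ} (ξ : Multiset (Fin n →₀ ℕ))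
    (v : Fin n →₀ ℕ) : gradedPiece K ξ v ≃ₗ[K] ({e : ξ // e.1 ≤ v} → K) := by
  classical
  exact
  { toFun := fun f e => coeff (v - e.1.1) (f.1 e.1)
    map_add' := by intro f g; ext e; simp
    map_smul' := by intro c f; ext e; simp
    invFun := fun a => ⟨Finsupp.equivFunOnFinite.symm fun e =>
        if h : e.1 ≤ v then monomial (v - e.1) (a ⟨e, h⟩) else 0, by
      intro e d h
      by_cases he : e.1 ≤ v
      · simp only [Finsupp.equivFunOnFinite_symm_apply_apply, he, dif_pos, coeff_monomial] at h
        by_cases hd : v - e.1 = d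
        · rw [← hd, add_tsub_cancel_of_le he]
        · simp [hd] at h
      · simp [he] at h⟩
    left_inv := by
      intro f
      ext e d
      by_cases he : e.1 ≤ v
      · simp only [Finsupp.equivFunOnFinite_symm_apply_apply, he, dif_pos, coeff_monomial]
        by_cases hd : v - e.1 = d
        · simp [hd]
        · rw [if_neg hd]
          by_contra h
          exact hd (by rw [← f.2 e d (Ne.symm h), add_tsub_cancel_left])
      · simp only [Finsupp.equivFunOnFinite_symm_apply_apply, he, dif_neg, not_false_eq_true,
          coeff_zero]
        by_contra h
        exact he (by rw [← f.2 e d (Ne.symm h)]; exact le_self_add)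
    right_inv := by
      intro a
      ext e
      simp [e.2] }

/-- The monomial basis `x^(v - deg e) · e`, `e ∈ ξ` with `deg e ≤ v`, of `F(ξ)_v`. -/
noncomputable def pieceBasis (K : Type*) [Field K] {n : ℕ} (ξ : Multiset (Fin n →₀ ℕ))
    (v : Fin n →₀ ℕ) : Basis {e : ξ // e.1 ≤ v} K (gradedPiece K ξ v) :=
  Basis.ofEquivFun (pieceEquiv K ξ v)

instance finite_gradedPiece (K : Type*) [Field K] {n : ℕ} (ξ : Multiset (Fin n →₀ ℕ))
    (v : Fin n →₀ ℕ) : Module.Finite K (gradedPiece K ξ v) :=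
  Module.Finite.of_basis (pieceBasis K ξ v)

theorem finrank_gradedPiece (K : Type*) [Field K] {n : ℕ} (ξ : Multiset (Fin n →₀ ℕ))
    (v : Fin n →₀ ℕ) : finrank K (gradedPiece K ξ v) = pieceDim ξ v :=
  finrank_eq_nat_card_basis (pieceBasis K ξ v)

/-! ### Relation families -/

/-- A relation family: subspaces `V_v ⊆ F(ξ₀)_v`, one for each degree `v` occurring in `ξ₁`, with
`dim V_v = dim F(ξ₁)_v` and `x^(v-u) V_u ⊆ V_v` whenever `u ≤ v`. The type
`RelationFamily K ξ₀ ξ₁` is the set `RF(ξ₀, ξ₁)` over the field `K`. -/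
@[ext] structure RelationFamily (K : Type*) [Field K] {n : ℕ} (ξ₀ ξ₁ : Multiset (Fin n →₀ ℕ)) where
  space : {v // v ∈ ξ₁} → Submodule K (FreeGraded K ξ₀)
  space_le : ∀ v, space v ≤ gradedPiece K ξ₀ v.1
  finrank_space : ∀ v, finrank K (space v) = finrank K (gradedPiece K ξ₁ v.1)
  smul_mem : ∀ u v : {v // v ∈ ξ₁}, u.1 ≤ v.1 → ∀ f ∈ space u,
    (monomial (v.1 - u.1) (1 : K) : MvPolynomial (Fin n) K) • f ∈ space v

/-! ### Grassmannians and their projective coordinates -/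

/-- The Grassmannian `Gr_m(W)` of `m`-dimensional subspaces of a finite-dimensional space `W`. -/
def Grassmann (K : Type*) [Field K] (W : Type*) [AddCommGroup W] [Module K W] [Module.Finite K W]
    (m : ℕ) : Type _ :=
  {V : Submodule K W // finrank K V = m}

/-- The vector of maximal minors of the coordinate matrix (with respect to the basis `b` of `W`)
of a tuple `c` of `m` vectors of `W`. It is indexed by all `m`-tuples `I` of indices: permuting `I`
changes the minor by a sign, and a repetition in `I` makes it zero. -/
noncomputable def minors {K W B : Type*} [Field K] [AddCommGroup W] [Module K W]
    (b : Basis B K W) {m : ℕ} (c : Fin m → W) : (Fin m → B) → K :=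
  fun I => (Matrix.of fun i j => b.repr (c i) (I j)).det

theorem minors_ne_zero {K W B : Type*} [Field K] [AddCommGroup W] [Module K W] [Finite B]
    (b : Basis B K W) {m : ℕ} (c : Fin m → W) (hc : LinearIndependent K c) :
    minors b c ≠ 0 := by
  classical
  cases nonempty_fintype B
  intro h0
  obtain ⟨g, hg⟩ := (Fintype.linearCombination K c).exists_leftInverse_of_injective
    (LinearMap.ker_eq_bot.2 (linearIndependent_iff_injective_fintypeLinearCombination.1 hc))
  have hgc : ∀ i, g (c i) = Pi.single i 1 := fun i => by
    have := LinearMap.congr_fun hg (Pi.single i 1)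
    simpa [Fintype.linearCombination_apply_single] using this
  -- the identity matrix, with columns expanded in the columns of the coordinate matrix of `c`
  have hone : ∀ j : Fin m, (1 : Matrix (Fin m) (Fin m) K) j =
      ∑ x : B, g (b x) j • fun i => b.repr (c i) x := by
    intro j
    ext i
    have h1 : g (c i) j = ∑ x : B, b.repr (c i) x * g (b x) j := by
      conv_lhs => rw [← b.sum_repr (c i)]
      simp [-Basis.sum_repr]
    rw [hgc] at h1
    simp only [Finset.sum_apply, Pi.smul_apply, smul_eq_mul]
    rw [Matrix.one_apply, ← Pi.single_apply, h1]
    exact Finset.sum_congr rfl fun x _ => mul_comm _ _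
  have hdet : (Matrix.detRowAlternating : (Fin m → K) [⋀^Fin m]→ₗ[K] K).toMultilinearMap
      (fun j => ∑ x : B, g (b x) j • fun i => b.repr (c i) x) = 0 := by
    rw [MultilinearMap.map_sum]
    refine Finset.sum_eq_zero fun I _ => ?_
    rw [MultilinearMap.map_smul_univ]
    have h2 := congrFun h0 I
    rw [minors, ← Matrix.det_transpose] at h2
    exact smul_eq_zero_of_right _ h2
  have h3 : (1 : Matrix (Fin m) (Fin m) K).det = 0 := by
    rw [← hdet]
    exact congrArg Matrix.det (funext hone)
  simp at h3

/-- The Plücker point of an `m`-dimensional subspace `V` of `W`, in the Plücker coordinates given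
by the basis `b` of `W`: the class of the vector of maximal minors of any basis of `V`. -/
noncomputable def pluckerPoint {K W B : Type*} [Field K] [AddCommGroup W] [Module K W]
    [Module.Finite K W] [Finite B] (b : Basis B K W) {m : ℕ} (V : Grassmann K W m) :
    Projectivization K ((Fin m → B) → K) :=
  Projectivization.mk K (minors b fun i => (finBasisOfFinrankEq K V.1 V.2 i : W))
    (minors_ne_zero b _
      ((finBasisOfFinrankEq K V.1 V.2).linearIndependent.map' V.1.subtype V.1.ker_subtype))

/-! ### The map `j` and the Plücker embedding of the product of Grassmannians -/

/-- The product `∏_{v ∈ ξ₁} Gr_{dim F(ξ₁)_v}(F(ξ₀)_v)`. -/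
abbrev GrassmannProduct (K : Type*) [Field K] {n : ℕ} (ξ₀ ξ₁ : Multiset (Fin n →₀ ℕ)) : Type _ :=
  ∀ v : {v // v ∈ ξ₁}, Grassmann K (gradedPiece K ξ₀ v.1) (pieceDim ξ₁ v.1)

/-- The map `j`: each `V_v`, regarded as a subspace of `F(ξ₀)_v`. -/
noncomputable def relationFamilyToGrassmann (K : Type*) [Field K] {n : ℕ} (ξ₀ ξ₁ : Multiset (Fin n →₀ ℕ))
    (V : RelationFamily K ξ₀ ξ₁) : GrassmannProduct K ξ₀ ξ₁ :=
  fun v => ⟨(V.space v).comap (gradedPiece K ξ₀ v.1).subtype, by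
    rw [← finrank_gradedPiece K ξ₁ v.1, ← V.finrank_space v]
    exact (Submodule.comapSubtypeEquivOfLe (V.space_le v)).finrank_eq⟩

/-- The index set of the Plücker coordinates of the factor `Gr_{dim F(ξ₁)_v}(F(ξ₀)_v)`. -/
abbrev PluckerIndex {n : ℕ} (ξ₀ ξ₁ : Multiset (Fin n →₀ ℕ)) (v : {v // v ∈ ξ₁}) : Type :=
  Fin (pieceDim ξ₁ v.1) → {e : ξ₀ // e.1 ≤ v.1}

/-- The product of the Plücker embeddings of the factors, in the coordinates given by the monomial
bases of the spaces `F(ξ₀)_v`. -/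
noncomputable def pluckerMap (K : Type*) [Field K] {n : ℕ} (ξ₀ ξ₁ : Multiset (Fin n →₀ ℕ))
    (P : GrassmannProduct K ξ₀ ξ₁) :
    ∀ v : {v // v ∈ ξ₁}, Projectivization K (PluckerIndex ξ₀ ξ₁ v → K) :=
  fun v => pluckerPoint (pieceBasis K ξ₀ v.1) (P v)

/-! ### Closed subsets of products of projective spaces -/

/-- A polynomial in several groups of variables, the group `i` being indexed by `σ i`, is
multihomogeneous if it is homogeneous of some degree `d i` in each group. -/
def IsMultihomogeneous {k ι : Type*} [Field k] [DecidableEq ι] {σ : ι → Type*}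
    (p : MvPolynomial (Σ i, σ i) k) : Prop :=
  ∃ d : ι → ℕ, IsWeightedHomogeneous (fun x : Σ i, σ i => (Pi.single x.1 1 : ι → ℕ)) p d

/-- The set of `K`-points of `∏_i ℙ(K^(σ i))` at which all polynomials of `S` (with coefficients in
a field `k` with `K` over `k`) vanish. For multihomogeneous polynomials the choice of the
representatives of the points does not matter. -/
def multiprojectiveZeroLocus {k ι : Type*} [Field k] {σ : ι → Type*}
    (S : Set (MvPolynomial (Σ i, σ i) k)) (K : Type*) [Field K] [Algebra k K] :
    Set (∀ i, Projectivization K (σ i → K)) :=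
  {P | ∀ p ∈ S, aeval (fun x : Σ i, σ i => (P x.1).rep x.2) p = 0}

/-! ### Subspaces in terms of their maximal minors -/

/-! The point is that containments between subspaces are polynomial in their Plücker coordinates.
Let `A` be the coordinate matrix of a basis `c` of `V`, `A_I` the square submatrix on columns `I`,
and `p` the vector of maximal minors. By Cramer's rule the rows of `adj(A_I) * A` have entries `p
(Function.update I i x)`. So these frame vectors lie in `V`, have coordinates linear in `p`, and
express `p I • c j` with coefficients the coordinates of `c j` at `I`. Since some `p I` is nonzero,
they span `V` (`span_eq_span_frameVector`), and `w ∈ V` becomes a system linear in `w` and in `p`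
(`mem_span_iff_memRelation`).

Hence `x^(v-u) P_u ⊆ P_v` need only be tested on frame vectors of `P_u`, which gives products of one
coordinate from factor `u` and one from factor `v`. Together with the determinantal relations, which
characterize Plücker points (`mem_range_pluckerPoint`), these form `S`. The equations have the same
shape over every `K`. All relations are homogeneous, so the lemmas allow a scalar `a`, as a
representative of a projective point is known only up to scaling. The claims about `j` itself only
move subspaces along the inclusion of a graded piece. -/

section Minors

variable {K W B : Type*} [Field K] [AddCommGroup W] [Module K W]

open Classical in
/-- The vector whose coordinate at `x` is the value of `p` at the tuple `I` with its `i`-th entry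
replaced by `x`. For `p` the vector of maximal minors of a subspace these vectors span it. -/
noncomputable def frameVector [Finite B] (b : Basis B K W) {m : ℕ} (p : (Fin m → B) → K)
    (I : Fin m → B) (i : Fin m) : W :=
  b.repr.symm (Finsupp.equivFunOnFinite.symm fun x => p (Function.update I i x))

open Classical in
theorem repr_frameVector [Finite B] (b : Basis B K W) {m : ℕ} (p : (Fin m → B) → K)
    (I : Fin m → B) (i : Fin m) (x : B) :
    b.repr (frameVector b p I i) x = p (Function.update I i x) := by
  simp [frameVector]

theorem frameVector_smul [Finite B] (b : Basis B K W) {m : ℕ} (a : K) (p : (Fin m → B) → K)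
    (I : Fin m → B) (i : Fin m) : frameVector b (a • p) I i = a • frameVector b p I i := by
  classical
  apply b.repr.injective
  ext x
  simp [repr_frameVector]

/-- The square submatrix of the coordinate matrix of `c` with columns given by `I`. -/
noncomputable def coordMatrix (b : Basis B K W) {m : ℕ} (c : Fin m → W) (I : Fin m → B) :
    Matrix (Fin m) (Fin m) K :=
  Matrix.of fun i j => b.repr (c i) (I j)

-- Cramer's rule: the update replaces column `i` of `A_I` by column `x` of the coordinate matrix.
open Classical in
theorem minors_update (b : Basis B K W) {m : ℕ} (c : Fin m → W) (I : Fin m → B) (i : Fin m)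
    (x : B) : minors b c (Function.update I i x) =
      ∑ j, (coordMatrix b c I).adjugate i j * b.repr (c j) x := by
  have h : (coordMatrix b c I).adjugate.mulVec (fun j => b.repr (c j) x) i =
      minors b c (Function.update I i x) := by
    rw [← Matrix.cramer_eq_adjugate_mulVec, Matrix.cramer_apply, minors]
    congr 1
    ext s t
    by_cases h : t = i
    · subst h; simp
    · simp [h, coordMatrix]
  rw [← h]
  rfl

theorem frameVector_minors [Finite B] (b : Basis B K W) {m : ℕ} (c : Fin m → W)
    (I : Fin m → B) (i : Fin m) :
    frameVector b (minors b c) I i = ∑ j, (coordMatrix b c I).adjugate i j • c j := by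
  classical
  apply b.repr.injective
  ext x
  rw [repr_frameVector, minors_update]
  simp [Finsupp.finsetSum_apply]

/-- The identity `A_I * adj(A_I) = det(A_I)` inverts `frameVector_minors` up to the factor `minors b
c I`. -/
theorem sum_repr_smul_frameVector_minors [Finite B] (b : Basis B K W) {m : ℕ} (c : Fin m → W)
    (I : Fin m → B) (j : Fin m) :
    ∑ i, b.repr (c j) (I i) • frameVector b (minors b c) I i = minors b c I • c j := by
  have h : ∀ l, ∑ i, b.repr (c j) (I i) * (coordMatrix b c I).adjugate i l =
      if j = l then minors b c I else 0 := by
    intro l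
    have := congrFun (congrFun (Matrix.mul_adjugate (coordMatrix b c I)) j) l
    rw [Matrix.mul_apply, Matrix.smul_apply, Matrix.one_apply] at this
    simpa [coordMatrix, minors] using this
  simp only [frameVector_minors, Finset.smul_sum, smul_smul]
  rw [Finset.sum_comm]
  simp only [← Finset.sum_smul, h, ite_smul, zero_smul]
  simp

open Classical in
/-- The determinantal relations cutting out the image of a Grassmannian. -/
def DetRelation {m : ℕ} (p : (Fin m → B) → K) (I J : Fin m → B) : Prop :=
  p I ^ m * p J = p I * (Matrix.of fun i s => p (Function.update I i (J s))).det

/-- The matrix in the relation is `adj(A_I) * A_J`, up to scaling. The extra factor `p I` turns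
`det(adj(A_I))` into `det(A_I) ^ m`, avoiding the exponent `m - 1`, and both sides have degree `m +
1` even for `m = 0`. -/
theorem detRelation_smul_minors (b : Basis B K W) {m : ℕ} (a : K) (c : Fin m → W)
    (I J : Fin m → B) : DetRelation (a • minors b c) I J := by
  classical
  have h1 : (Matrix.of fun i s => (a • minors b c) (Function.update I i (J s))) =
      a • ((coordMatrix b c I).adjugate * coordMatrix b c J) := by
    ext i s
    simp [minors_update, Matrix.mul_apply, coordMatrix]
  have h2 : (coordMatrix b c I).det * (coordMatrix b c I).adjugate.det =
      (coordMatrix b c I).det ^ m := by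
    rw [← Matrix.det_mul, Matrix.mul_adjugate]
    simp
  have hI : minors b c I = (coordMatrix b c I).det := rfl
  have hJ : minors b c J = (coordMatrix b c J).det := rfl
  rw [DetRelation, h1, Matrix.det_smul, Matrix.det_mul]
  simp only [Pi.smul_apply, smul_eq_mul, hI, hJ, Fintype.card_fin, mul_pow]
  rw [← h2]
  ring

/-- The linear relations, with coefficients in the maximal minors, for membership in a subspace. -/
def MemRelation [DecidableEq B] {m : ℕ} (p : (Fin m → B) → K) (w : B → K)
    (I : Fin m → B) (x : B) : Prop :=
  p I * w x = ∑ i, w (I i) * p (Function.update I i x)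

open Classical in
theorem memRelation_iff [Finite B] (b : Basis B K W) {m : ℕ} (p : (Fin m → B) → K) (w : W)
    (I : Fin m → B) :
    (∀ x, MemRelation p (b.repr w) I x) ↔
      p I • w = ∑ i, b.repr w (I i) • frameVector b p I i := by
  rw [← b.repr.injective.eq_iff, Finsupp.ext_iff]
  simp [MemRelation, Finsupp.finsetSum_apply, repr_frameVector]

theorem frameVector_smul_minors_mem_span [Finite B] (b : Basis B K W) {m : ℕ} (a : K)
    (c : Fin m → W) (I : Fin m → B) (i : Fin m) :
    frameVector b (a • minors b c) I i ∈ Submodule.span K (Set.range c) := by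
  rw [frameVector_smul, frameVector_minors]
  exact Submodule.smul_mem _ _ (Submodule.sum_mem _ fun j _ =>
    Submodule.smul_mem _ _ (Submodule.subset_span ⟨j, rfl⟩))

-- The relations are linear in `w`, so one direction is checked on the generators `c j`. Conversely
-- a single `I` with `p I ≠ 0` suffices; imposing all `I` avoids choosing a chart.
open Classical in
theorem mem_span_iff_memRelation [Finite B] (b : Basis B K W) {m : ℕ} {p : (Fin m → B) → K}
    (hp : p ≠ 0) {a : K} {c : Fin m → W} (hc : p = a • minors b c) (w : W) :
    w ∈ Submodule.span K (Set.range c) ↔ ∀ I x, MemRelation p (b.repr w) I x := by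
  simp only [memRelation_iff]
  constructor
  · intro hw I
    induction hw using Submodule.span_induction with
    | mem w hw =>
      obtain ⟨j, rfl⟩ := hw
      simp only [hc, frameVector_smul, Pi.smul_apply, smul_assoc,
        ← sum_repr_smul_frameVector_minors, Finset.smul_sum]
      exact Finset.sum_congr rfl fun i _ => smul_comm _ _ _
    | zero => simp
    | add w w' _ _ h h' => simp [h, h', add_smul, Finset.sum_add_distrib]
    | smul r w _ h =>
      rw [smul_comm, h, Finset.smul_sum]
      simp [smul_smul]
  · intro h
    obtain ⟨I, hI⟩ := Function.ne_iff.1 hp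
    rw [← Submodule.smul_mem_iff _ (show p I ≠ 0 from hI), h I, hc]
    exact Submodule.sum_mem _ fun i _ => Submodule.smul_mem _ _
      (frameVector_smul_minors_mem_span b a c I i)

theorem span_eq_span_frameVector [Finite B] (b : Basis B K W) {m : ℕ} {p : (Fin m → B) → K}
    (hp : p ≠ 0) {a : K} {c : Fin m → W} (hc : p = a • minors b c) :
    Submodule.span K (Set.range c) =
      Submodule.span K (Set.range fun q : (Fin m → B) × Fin m => frameVector b p q.1 q.2) := by
  classical
  apply le_antisymm
  · intro w hw
    rw [mem_span_iff_memRelation b hp hc] at hw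
    obtain ⟨I, hI⟩ := Function.ne_iff.1 hp
    rw [← Submodule.smul_mem_iff _ (show p I ≠ 0 from hI), (memRelation_iff b p w I).1 (hw I)]
    exact Submodule.sum_mem _ fun i _ => Submodule.smul_mem _ _
      (Submodule.subset_span ⟨(I, i), rfl⟩)
  · rw [Submodule.span_le]
    rintro _ ⟨⟨I, i⟩, rfl⟩
    rw [hc]
    exact frameVector_smul_minors_mem_span b a c I i

theorem minors_eq_smul_of_mem_span (b : Basis B K W) {m : ℕ} {c c' : Fin m → W}
    (h : ∀ i, c' i ∈ Submodule.span K (Set.range c)) :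
    ∃ a : K, minors b c' = a • minors b c := by
  simp only [Submodule.mem_span_range_iff_exists_fun] at h
  choose M hM using h
  refine ⟨(Matrix.of M).det, funext fun I => ?_⟩
  have h1 : (Matrix.of fun i j => b.repr (c' i) (I j)) = Matrix.of M * coordMatrix b c I := by
    ext i j
    simp [← hM, Matrix.mul_apply, coordMatrix, Finsupp.finsetSum_apply]
  rw [minors, h1, Matrix.det_mul]
  rfl

theorem linearIndependent_of_minors_ne_zero (b : Basis B K W) {m : ℕ} {c : Fin m → W}
    (h : minors b c ≠ 0) : LinearIndependent K c := by
  obtain ⟨I, hI⟩ := Function.ne_iff.1 h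
  have h1 := Matrix.linearIndependent_rows_of_det_ne_zero
    (A := Matrix.of fun i j => b.repr (c i) (I j)) hI
  let f : W →ₗ[K] (Fin m → K) := LinearMap.pi fun j => b.coord (I j)
  exact LinearIndependent.of_comp f h1

theorem exists_eq_smul_minors [Finite B] (b : Basis B K W) {m : ℕ} {p : (Fin m → B) → K}
    (hp : p ≠ 0) (hdet : ∀ I J, DetRelation p I J) :
    ∃ (a : K) (c : Fin m → W), p = a • minors b c := by
  classical
  obtain ⟨I, hI⟩ := Function.ne_iff.1 hp
  replace hI : p I ≠ 0 := hI
  -- If `p` does come from a subspace, these vectors are its basis with identity matrix in the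
  -- columns `I`. Their minor at `J` is `(p I)⁻¹ ^ m` times the determinant in `DetRelation`.
  refine ⟨p I, fun i => (p I)⁻¹ • frameVector b p I i, funext fun J => ?_⟩
  have h1 : (Matrix.of fun i j => b.repr ((p I)⁻¹ • frameVector b p I i) (J j)) =
      (p I)⁻¹ • Matrix.of fun i s => p (Function.update I i (J s)) := by
    ext i j
    simp [repr_frameVector]
  have h2 := hdet I J
  rw [DetRelation] at h2
  rw [Pi.smul_apply, minors, h1, Matrix.det_smul, Fintype.card_fin, smul_eq_mul, mul_left_comm,
    ← h2, ← mul_assoc, ← mul_pow, inv_mul_cancel₀ hI, one_pow, one_mul]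

end Minors

/-! ### The Plücker embedding of one Grassmannian -/

section Grassmannian

variable {K W B : Type*} [Field K] [AddCommGroup W] [Module K W] [Module.Finite K W] [Finite B]

theorem exists_rep_pluckerPoint (b : Basis B K W) {m : ℕ} (V : Grassmann K W m) :
    ∃ (a : K) (c : Fin m → W), (pluckerPoint b V).rep = a • minors b c ∧
      V.1 = Submodule.span K (Set.range c) := by
  obtain ⟨a, ha⟩ := Projectivization.exists_smul_eq_mk_rep K
    (minors b fun i => (finBasisOfFinrankEq K V.1 V.2 i : W))
    (minors_ne_zero b _
      ((finBasisOfFinrankEq K V.1 V.2).linearIndependent.map' V.1.subtype V.1.ker_subtype))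
  refine ⟨a, _, ha.symm, ?_⟩
  have h := congrArg (Submodule.map V.1.subtype) (finBasisOfFinrankEq K V.1 V.2).span_eq
  rw [Submodule.map_span, Submodule.map_top, Submodule.range_subtype, ← Set.range_comp] at h
  exact h.symm

open Classical in
theorem mem_iff_memRelation (b : Basis B K W) {m : ℕ} (V : Grassmann K W m) (w : W) :
    w ∈ V.1 ↔ ∀ I x, MemRelation (pluckerPoint b V).rep (b.repr w) I x := by
  obtain ⟨a, c, h, hV⟩ := exists_rep_pluckerPoint b V
  rw [hV, mem_span_iff_memRelation b (Projectivization.rep_nonzero _) h]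

theorem eq_span_frameVector (b : Basis B K W) {m : ℕ} (V : Grassmann K W m) :
    V.1 = Submodule.span K (Set.range fun q : (Fin m → B) × Fin m =>
      frameVector b (pluckerPoint b V).rep q.1 q.2) := by
  obtain ⟨a, c, h, hV⟩ := exists_rep_pluckerPoint b V
  rw [hV, span_eq_span_frameVector b (Projectivization.rep_nonzero _) h]

theorem pluckerPoint_injective (b : Basis B K W) (m : ℕ) :
    Function.Injective (pluckerPoint b : Grassmann K W m → _) := by
  classical
  intro V V' h
  refine Subtype.ext (Submodule.ext fun w => ?_)
  rw [mem_iff_memRelation b V, mem_iff_memRelation b V', h]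

theorem mem_range_pluckerPoint (b : Basis B K W) {m : ℕ}
    (P : Projectivization K ((Fin m → B) → K)) :
    P ∈ Set.range (pluckerPoint b : Grassmann K W m → _) ↔ ∀ I J, DetRelation P.rep I J := by
  constructor
  · rintro ⟨V, rfl⟩ I J
    obtain ⟨a, c, h, -⟩ := exists_rep_pluckerPoint b V
    rw [h]
    exact detRelation_smul_minors b a c I J
  · intro h
    obtain ⟨a, c, hc⟩ := exists_eq_smul_minors b P.rep_nonzero h
    have hli : LinearIndependent K c := by
      refine linearIndependent_of_minors_ne_zero b fun h0 => P.rep_nonzero ?_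
      rw [hc, h0, smul_zero]
    let V : Grassmann K W m :=
      ⟨Submodule.span K (Set.range c), by rw [finrank_span_eq_card hli, Fintype.card_fin]⟩
    obtain ⟨a', c', h', hV⟩ := exists_rep_pluckerPoint b V
    -- The tuple `c'` that describes `pluckerPoint b V` need not be `c`; the minors differ by the
    -- determinant of the change of basis.
    obtain ⟨r, hr⟩ := minors_eq_smul_of_mem_span b (c := c') (c' := c) fun i =>
      hV ▸ Submodule.subset_span ⟨i, rfl⟩
    have ha' : a' ≠ 0 := by
      rintro rfl
      exact (pluckerPoint b V).rep_nonzero (by rw [h', zero_smul])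
    refine ⟨V, ?_⟩
    rw [← (pluckerPoint b V).mk_rep, ← P.mk_rep, eq_comm, Projectivization.mk_eq_mk_iff']
    refine ⟨a * r * a'⁻¹, ?_⟩
    rw [h', hc, hr, smul_smul, smul_smul, mul_assoc, inv_mul_cancel₀ ha', mul_one]

end Grassmannian

/-! ### Multiplication by monomials -/

section Shift

variable (K : Type*) [Field K] {n : ℕ} (ξ : Multiset (Fin n →₀ ℕ))

/-- Multiplication by `x^(v-u)` from the piece of degree `u` to the piece of degree `v`. -/
noncomputable def gradedShift {u v : Fin n →₀ ℕ} (h : u ≤ v) :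
    gradedPiece K ξ u →ₗ[K] gradedPiece K ξ v where
  toFun f := ⟨(monomial (v - u) (1 : K) : MvPolynomial (Fin n) K) • f.1, by
    classical
    intro e d hd
    rw [Finsupp.smul_apply, smul_eq_mul, coeff_monomial_mul'] at hd
    split_ifs at hd with hle
    · rw [one_mul] at hd
      rw [← add_tsub_cancel_of_le hle, add_left_comm, f.2 e _ hd, tsub_add_cancel_of_le h]
    · exact absurd rfl hd⟩
  map_add' f g := Subtype.ext (smul_add _ _ _)
  map_smul' r f := Subtype.ext (smul_comm _ _ _)

-- Multiplication by `x^(v-u)` sends the monomial basis vector of `e` in degree `u` to that of `e`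
-- in degree `v`, so coordinates are extended by zero.
open Classical in
theorem pieceBasis_repr_gradedShift {u v : Fin n →₀ ℕ} (h : u ≤ v) (f : gradedPiece K ξ u)
    (e : {e : ξ // e.1 ≤ v}) :
    (pieceBasis K ξ v).repr (gradedShift K ξ h f) e =
      if he : e.1.1 ≤ u then (pieceBasis K ξ u).repr f ⟨e.1, he⟩ else 0 := by
  change coeff (v - e.1.1) ((monomial (v - u) (1 : K) : MvPolynomial (Fin n) K) * f.1 e.1) = _
  split_ifs with he
  · change _ = coeff (u - e.1.1) (f.1 e.1)
    rw [← tsub_add_tsub_cancel h he, coeff_monomial_mul, one_mul]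
  · rw [coeff_monomial_mul']
    split_ifs
    · rw [one_mul]
      by_contra h0
      exact he (le_self_add.trans (f.2 _ _ h0).le)
    · rfl

end Shift

/-! ### Relation families inside the product of Grassmannians -/

section Range

variable (K : Type*) [Field K] {n : ℕ} (ξ₀ ξ₁ : Multiset (Fin n →₀ ℕ))

theorem map_space_relationFamilyToGrassmann (V : RelationFamily K ξ₀ ξ₁) (v : {v // v ∈ ξ₁}) :
    (relationFamilyToGrassmann K ξ₀ ξ₁ V v).1.map (gradedPiece K ξ₀ v.1).subtype = V.space v := by
  change ((V.space v).comap (gradedPiece K ξ₀ v.1).subtype).map _ = _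
  rw [Submodule.map_comap_subtype, inf_eq_right.2 (V.space_le v)]

theorem relationFamilyToGrassmann_injective :
    Function.Injective (relationFamilyToGrassmann K ξ₀ ξ₁) := by
  intro V V' h
  refine RelationFamily.ext (funext fun v => ?_)
  rw [← map_space_relationFamilyToGrassmann, h, map_space_relationFamilyToGrassmann]

theorem range_relationFamilyToGrassmann :
    Set.range (relationFamilyToGrassmann K ξ₀ ξ₁) =
      {P | ∀ u v : {v // v ∈ ξ₁}, u.1 ≤ v.1 →
        ∀ f ∈ (P u).1.map (gradedPiece K ξ₀ u.1).subtype,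
          (monomial (v.1 - u.1) (1 : K) : MvPolynomial (Fin n) K) • f ∈
            (P v).1.map (gradedPiece K ξ₀ v.1).subtype} := by
  ext P
  constructor
  · rintro ⟨V, rfl⟩ u v h f hf
    rw [map_space_relationFamilyToGrassmann] at hf ⊢
    exact V.smul_mem u v h f hf
  · intro hP
    refine ⟨⟨fun v => (P v).1.map (gradedPiece K ξ₀ v.1).subtype, fun v =>
      Submodule.map_subtype_le _ _, fun v => ?_, hP⟩, funext fun v => Subtype.ext ?_⟩
    · exact (Submodule.equivMapOfInjective _ (Submodule.subtype_injective _) (P v).1).finrank_eq.symm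
        |>.trans ((P v).2.trans (finrank_gradedPiece K ξ₁ v.1).symm)
    · exact Submodule.comap_map_eq_of_injective (Submodule.subtype_injective _) _

theorem mem_range_relationFamilyToGrassmann_iff (P : GrassmannProduct K ξ₀ ξ₁) :
    P ∈ Set.range (relationFamilyToGrassmann K ξ₀ ξ₁) ↔
      ∀ (u v : {v // v ∈ ξ₁}) (h : u.1 ≤ v.1), ∀ f ∈ (P u).1,
        gradedShift K ξ₀ h f ∈ (P v).1 := by
  rw [range_relationFamilyToGrassmann]
  refine forall₃_congr fun u v h => ⟨fun H f hf => ?_, ?_⟩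
  · obtain ⟨g, hg, hgf⟩ := H f (Submodule.mem_map_of_mem hf)
    rwa [← show g = gradedShift K ξ₀ h f from Subtype.ext hgf]
  · rintro H _ ⟨f, hf, rfl⟩
    exact ⟨_, H f hf, rfl⟩

end Range

/-! ### The equations -/

section Polynomials

variable (k : Type*) [Field k] {ι : Type*} {m : ι → ℕ} {B : ι → Type*}

open Classical in
/-- The polynomial expressing `DetRelation` in the factor `v`. -/
noncomputable def detPolynomial (v : ι) (I J : Fin (m v) → B v) :
    MvPolynomial (Σ v, Fin (m v) → B v) k :=
  X ⟨v, I⟩ ^ m v * X ⟨v, J⟩ -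
    X ⟨v, I⟩ * (Matrix.of fun i s => X ⟨v, Function.update I i (J s)⟩).det

/-- The polynomial expressing `MemRelation` in the factor `v`, for the vector with coordinates
`Y`. -/
noncomputable def memPolynomial {v : ι} [DecidableEq (B v)]
    (Y : B v → MvPolynomial (Σ v, Fin (m v) → B v) k) (I : Fin (m v) → B v) (x : B v) :
    MvPolynomial (Σ v, Fin (m v) → B v) k :=
  X ⟨v, I⟩ * Y x - ∑ i, Y (I i) * X ⟨v, Function.update I i x⟩

theorem isWeightedHomogeneous_pluckerVariable [DecidableEq ι] (v : ι) (I : Fin (m v) → B v) :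
    IsWeightedHomogeneous (fun x : Σ v, Fin (m v) → B v => (Pi.single x.1 1 : ι → ℕ))
      (X ⟨v, I⟩ : MvPolynomial (Σ v, Fin (m v) → B v) k) (Pi.single v 1) :=
  isWeightedHomogeneous_X k (fun x : Σ v, Fin (m v) → B v => (Pi.single x.1 1 : ι → ℕ)) ⟨v, I⟩

theorem isMultihomogeneous_detPolynomial [DecidableEq ι] (v : ι) (I J : Fin (m v) → B v) :
    IsMultihomogeneous (detPolynomial k v I J) := by
  classical
  have hX := isWeightedHomogeneous_pluckerVariable k (m := m) (B := B) v
  refine ⟨m v • Pi.single v 1 + Pi.single v 1, ?_⟩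
  refine Submodule.sub_mem (weightedHomogeneousSubmodule k _ _) (((hX I).pow _).mul (hX J)) ?_
  rw [add_comm, Matrix.det_apply]
  refine (hX I).mul (Submodule.sum_mem (weightedHomogeneousSubmodule k _ _) fun τ _ => ?_)
  rw [Units.smul_def]
  -- The sign of `τ` acts as an integer scalar, so only the product of `m v` variables of group `v`
  -- matters.
  refine zsmul_mem ?_ _
  simp only [Matrix.of_apply]
  have h := IsWeightedHomogeneous.prod Finset.univ _ (fun _ => Pi.single v 1)
    fun i _ => hX (Function.update I (τ i) (J i))
  rw [Finset.sum_const, Finset.card_univ, Fintype.card_fin] at h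
  exact h

theorem isMultihomogeneous_memPolynomial [DecidableEq ι] {v : ι} [DecidableEq (B v)]
    {Y : B v → MvPolynomial (Σ v, Fin (m v) → B v) k} {d : ι → ℕ}
    (hY : ∀ e, IsWeightedHomogeneous
      (fun x : Σ v, Fin (m v) → B v => (Pi.single x.1 1 : ι → ℕ)) (Y e) d)
    (I : Fin (m v) → B v) (x : B v) :
    IsMultihomogeneous (memPolynomial k Y I x) := by
  have hX := isWeightedHomogeneous_pluckerVariable k (m := m) (B := B) v
  refine ⟨Pi.single v 1 + d, ?_⟩
  refine Submodule.sub_mem (weightedHomogeneousSubmodule k _ _) ((hX I).mul (hY x)) ?_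
  rw [add_comm]
  exact Submodule.sum_mem (weightedHomogeneousSubmodule k _ _) fun i _ => (hY _).mul (hX _)

variable {K : Type*} [Field K] [Algebra k K] (p : ∀ v, (Fin (m v) → B v) → K)

theorem aeval_detPolynomial_eq_zero_iff (v : ι) (I J : Fin (m v) → B v) :
    aeval (fun x : Σ v, Fin (m v) → B v => p x.1 x.2) (detPolynomial k v I J) = 0 ↔
      DetRelation (p v) I J := by
  classical
  have h : (aeval fun x : Σ v, Fin (m v) → B v => p x.1 x.2).mapMatrix
      (Matrix.of fun i s => (X ⟨v, Function.update I i (J s)⟩ : MvPolynomial _ k)) =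
      Matrix.of fun i s => p v (Function.update I i (J s)) := by
    ext i s
    simp
  rw [detPolynomial, map_sub, sub_eq_zero, DetRelation, map_mul, map_mul, map_pow,
    AlgHom.map_det, aeval_X, aeval_X, h]

theorem aeval_memPolynomial_eq_zero_iff {v : ι} [DecidableEq (B v)]
    (Y : B v → MvPolynomial (Σ v, Fin (m v) → B v) k) (I : Fin (m v) → B v) (x : B v) :
    aeval (fun x : Σ v, Fin (m v) → B v => p x.1 x.2) (memPolynomial k Y I x) = 0 ↔
      MemRelation (p v)
        (fun e => aeval (fun x : Σ v, Fin (m v) → B v => p x.1 x.2) (Y e)) I x := by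
  simp only [memPolynomial, map_sub, sub_eq_zero, MemRelation, map_mul, map_sum, aeval_X]

end Polynomials

/-! ### Grassmannian and incidence equations on the product -/

section Equations

set_option maxSynthPendingDepth 3

variable (k : Type*) [Field k] {n : ℕ} (ξ₀ ξ₁ : Multiset (Fin n →₀ ℕ))

open Classical in
/-- The coordinate at `e` of the product of `x^(v-u)` and a frame vector in the factor `u`. -/
noncomputable def shiftCoordinate (u v : {v // v ∈ ξ₁}) (J : PluckerIndex ξ₀ ξ₁ u)
    (j : Fin (pieceDim ξ₁ u.1)) (e : {e : ξ₀ // e.1 ≤ v.1}) :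
    MvPolynomial (Σ v : {v // v ∈ ξ₁}, PluckerIndex ξ₀ ξ₁ v) k :=
  if h : e.1.1 ≤ u.1 then X ⟨u, Function.update J j ⟨e.1, h⟩⟩ else 0

open Classical in
/-- The polynomial expressing that the product of `x^(v-u)` and a frame vector in the factor `u`
lies in the subspace in the factor `v`. -/
noncomputable def incidencePolynomial (u v : {v // v ∈ ξ₁}) (J : PluckerIndex ξ₀ ξ₁ u)
    (j : Fin (pieceDim ξ₁ u.1)) (I : PluckerIndex ξ₀ ξ₁ v) (x : {e : ξ₀ // e.1 ≤ v.1}) :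
    MvPolynomial (Σ v : {v // v ∈ ξ₁}, PluckerIndex ξ₀ ξ₁ v) k :=
  memPolynomial k (m := fun v : {v // v ∈ ξ₁} => pieceDim ξ₁ v.1)
    (B := fun v : {v // v ∈ ξ₁} => {e : ξ₀ // e.1 ≤ v.1}) (v := v)
    (shiftCoordinate k ξ₀ ξ₁ u v J j) I x

/-- The polynomial expressing `DetRelation` in the factor `v` of the product of Grassmannians. -/
noncomputable def grassmannPolynomial (v : {v // v ∈ ξ₁}) (I J : PluckerIndex ξ₀ ξ₁ v) :
    MvPolynomial (Σ v : {v // v ∈ ξ₁}, PluckerIndex ξ₀ ξ₁ v) k :=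
  detPolynomial k (m := fun v : {v // v ∈ ξ₁} => pieceDim ξ₁ v.1)
    (B := fun v : {v // v ∈ ξ₁} => {e : ξ₀ // e.1 ≤ v.1}) v I J

/-- The equations of the set of relation families in the product of projective spaces. -/
def relationFamilyEquations :
    Set (MvPolynomial (Σ v : {v // v ∈ ξ₁}, PluckerIndex ξ₀ ξ₁ v) k) :=
  {p | (∃ v I J, p = grassmannPolynomial k ξ₀ ξ₁ v I J) ∨
    ∃ u v : {v // v ∈ ξ₁}, u.1 ≤ v.1 ∧ ∃ J j I x, p = incidencePolynomial k ξ₀ ξ₁ u v J j I x}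

theorem grassmannPolynomial_mem_relationFamilyEquations (v : {v // v ∈ ξ₁})
    (I J : PluckerIndex ξ₀ ξ₁ v) :
    grassmannPolynomial k ξ₀ ξ₁ v I J ∈ relationFamilyEquations k ξ₀ ξ₁ :=
  Or.inl ⟨v, I, J, rfl⟩

theorem incidencePolynomial_mem_relationFamilyEquations {u v : {v // v ∈ ξ₁}} (h : u.1 ≤ v.1)
    (J : PluckerIndex ξ₀ ξ₁ u) (j : Fin (pieceDim ξ₁ u.1)) (I : PluckerIndex ξ₀ ξ₁ v)
    (x : {e : ξ₀ // e.1 ≤ v.1}) :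
    incidencePolynomial k ξ₀ ξ₁ u v J j I x ∈ relationFamilyEquations k ξ₀ ξ₁ :=
  Or.inr ⟨u, v, h, J, j, I, x, rfl⟩

theorem forall_mem_relationFamilyEquations
    {C : MvPolynomial (Σ v : {v // v ∈ ξ₁}, PluckerIndex ξ₀ ξ₁ v) k → Prop}
    (h₁ : ∀ v I J, C (grassmannPolynomial k ξ₀ ξ₁ v I J))
    (h₂ : ∀ u v : {v // v ∈ ξ₁}, u.1 ≤ v.1 → ∀ J j I x, C (incidencePolynomial k ξ₀ ξ₁ u v J j I x)) :
    ∀ p ∈ relationFamilyEquations k ξ₀ ξ₁, C p := by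
  intro p hp
  change _ ∨ _ at hp
  obtain ⟨v, I, J, hp⟩ | ⟨u, v, h, J, j, I, x, hp⟩ := hp
  · rw [hp]
    exact h₁ v I J
  · rw [hp]
    exact h₂ u v h J j I x

theorem isWeightedHomogeneous_shiftCoordinate [DecidableEq {v // v ∈ ξ₁}]
    (u v : {v // v ∈ ξ₁}) (J : PluckerIndex ξ₀ ξ₁ u) (j : Fin (pieceDim ξ₁ u.1))
    (e : {e : ξ₀ // e.1 ≤ v.1}) :
    IsWeightedHomogeneous (fun x : Σ v : {v // v ∈ ξ₁}, PluckerIndex ξ₀ ξ₁ v =>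
      (Pi.single x.1 1 : {v // v ∈ ξ₁} → ℕ)) (shiftCoordinate k ξ₀ ξ₁ u v J j e)
      (Pi.single u 1) := by
  rw [shiftCoordinate]
  split_ifs
  · exact isWeightedHomogeneous_pluckerVariable k _ _
  -- Zero is homogeneous of every degree, so coordinates outside the piece of degree `u` do no harm.
  · exact isWeightedHomogeneous_zero _ _ _

theorem isMultihomogeneous_of_mem_relationFamilyEquations [DecidableEq {v // v ∈ ξ₁}] :
    ∀ p ∈ relationFamilyEquations k ξ₀ ξ₁, IsMultihomogeneous p := by
  classical
  refine forall_mem_relationFamilyEquations k ξ₀ ξ₁ (fun v I J => ?_) fun u v _ J j I x => ?_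
  · exact isMultihomogeneous_detPolynomial k (m := fun v : {v // v ∈ ξ₁} => pieceDim ξ₁ v.1)
      (B := fun v : {v // v ∈ ξ₁} => {e : ξ₀ // e.1 ≤ v.1}) v I J
  · exact isMultihomogeneous_memPolynomial k (m := fun v : {v // v ∈ ξ₁} => pieceDim ξ₁ v.1)
      (B := fun v : {v // v ∈ ξ₁} => {e : ξ₀ // e.1 ≤ v.1})
      (isWeightedHomogeneous_shiftCoordinate k ξ₀ ξ₁ u v J j) I x

variable (K : Type*) [Field K] [Algebra k K]

theorem aeval_shiftCoordinate
    (p : ∀ v : {v // v ∈ ξ₁}, PluckerIndex ξ₀ ξ₁ v → K)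
    {u v : {v // v ∈ ξ₁}} (h : u.1 ≤ v.1) (J : PluckerIndex ξ₀ ξ₁ u) (j : Fin (pieceDim ξ₁ u.1))
    (e : {e : ξ₀ // e.1 ≤ v.1}) :
    aeval (fun x : Σ v : {v // v ∈ ξ₁}, PluckerIndex ξ₀ ξ₁ v => p x.1 x.2)
      (shiftCoordinate k ξ₀ ξ₁ u v J j e) = (pieceBasis K ξ₀ v.1).repr (gradedShift K ξ₀ h
      (frameVector (pieceBasis K ξ₀ u.1) (p u) J j)) e := by
  classical
  rw [pieceBasis_repr_gradedShift, shiftCoordinate]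
  split_ifs with he
  · rw [aeval_X]
    exact (repr_frameVector _ _ _ _ _).symm
  · exact map_zero _

open Classical in
theorem aeval_incidencePolynomial_eq_zero_iff
    (p : ∀ v : {v // v ∈ ξ₁}, PluckerIndex ξ₀ ξ₁ v → K)
    {u v : {v // v ∈ ξ₁}} (h : u.1 ≤ v.1) (J : PluckerIndex ξ₀ ξ₁ u) (j : Fin (pieceDim ξ₁ u.1))
    (I : PluckerIndex ξ₀ ξ₁ v) (x : {e : ξ₀ // e.1 ≤ v.1}) :
    aeval (fun x : Σ v : {v // v ∈ ξ₁}, PluckerIndex ξ₀ ξ₁ v => p x.1 x.2)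
      (incidencePolynomial k ξ₀ ξ₁ u v J j I x) = 0 ↔
    MemRelation (p v) ((pieceBasis K ξ₀ v.1).repr (gradedShift K ξ₀ h
      (frameVector (pieceBasis K ξ₀ u.1) (p u) J j))) I x := by
  refine (aeval_memPolynomial_eq_zero_iff k p _ I x).trans ?_
  rw [funext (aeval_shiftCoordinate k ξ₀ ξ₁ K p h J j)]

theorem pluckerMap_injective : Function.Injective (pluckerMap K ξ₀ ξ₁) := by
  intro P Q h
  funext v
  have hv : pluckerPoint (pieceBasis K ξ₀ v.1) (P v) = pluckerPoint (pieceBasis K ξ₀ v.1) (Q v) :=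
    congrFun h v
  exact pluckerPoint_injective (pieceBasis K ξ₀ v.1) (pieceDim ξ₁ v.1) hv

/-- The shift is linear, so its containment is decided on the frame vectors spanning `P u`; there it
is exactly the incidence equations. The determinantal equations hold automatically at Plücker
points. -/
theorem pluckerMap_mem_zeroLocus_iff (P : GrassmannProduct K ξ₀ ξ₁) :
    pluckerMap K ξ₀ ξ₁ P ∈ multiprojectiveZeroLocus (relationFamilyEquations k ξ₀ ξ₁) K ↔
      P ∈ Set.range (relationFamilyToGrassmann K ξ₀ ξ₁) := by
  classical
  rw [mem_range_relationFamilyToGrassmann_iff]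
  constructor
  · intro hP u v h f hf
    rw [eq_span_frameVector (pieceBasis K ξ₀ u.1) (P u)] at hf
    induction hf using Submodule.span_induction with
    | mem f hf =>
      obtain ⟨⟨J, j⟩, rfl⟩ := hf
      rw [mem_iff_memRelation (pieceBasis K ξ₀ v.1)]
      intro I x
      exact (aeval_incidencePolynomial_eq_zero_iff k ξ₀ ξ₁ K
          (fun v => (pluckerMap K ξ₀ ξ₁ P v).rep) h J j I x).1
        (hP _ (incidencePolynomial_mem_relationFamilyEquations k ξ₀ ξ₁ h J j I x))
    | zero => rw [map_zero]; exact Submodule.zero_mem _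
    | add f g _ _ hf hg => rw [map_add]; exact Submodule.add_mem _ hf hg
    | smul r f _ hf => rw [map_smul]; exact Submodule.smul_mem _ _ hf
  · intro hP
    refine forall_mem_relationFamilyEquations k ξ₀ ξ₁ (fun v I J => ?_) fun u v h J j I x => ?_
    · refine (aeval_detPolynomial_eq_zero_iff k (fun v => (pluckerMap K ξ₀ ξ₁ P v).rep) v I J).2 ?_
      exact (mem_range_pluckerPoint (pieceBasis K ξ₀ v.1) _).1 ⟨P v, rfl⟩ I J
    · refine (aeval_incidencePolynomial_eq_zero_iff k ξ₀ ξ₁ K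
        (fun v => (pluckerMap K ξ₀ ξ₁ P v).rep) h J j I x).2 ?_
      refine (mem_iff_memRelation (pieceBasis K ξ₀ v.1) (P v) _).1 (hP u v h _ ?_) I x
      rw [eq_span_frameVector (pieceBasis K ξ₀ u.1) (P u)]
      exact Submodule.subset_span ⟨(J, j), rfl⟩

theorem zeroLocus_subset_range_pluckerMap :
    multiprojectiveZeroLocus (relationFamilyEquations k ξ₀ ξ₁) K ⊆
      Set.range (pluckerMap K ξ₀ ξ₁) := by
  intro P hP
  have h : ∀ v, P v ∈ Set.range (pluckerPoint (pieceBasis K ξ₀ v.1) :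
      Grassmann K (gradedPiece K ξ₀ v.1) (pieceDim ξ₁ v.1) → _) := fun v =>
    (mem_range_pluckerPoint _ _).2 fun I J =>
      (aeval_detPolynomial_eq_zero_iff k (fun v => (P v).rep) v I J).1 (hP _ (grassmannPolynomial_mem_relationFamilyEquations k ξ₀ ξ₁ v I J))
  choose V hV using h
  exact ⟨V, funext hV⟩

end Equations

theorem mainTheorem7 {k : Type u} [Field k] {n : ℕ} (ξ₀ ξ₁ : Multiset (Fin n →₀ ℕ)) :
    Function.Injective (relationFamilyToGrassmann k ξ₀ ξ₁) ∧
    Set.range (relationFamilyToGrassmann k ξ₀ ξ₁) =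
      {P | ∀ u v : {v // v ∈ ξ₁}, u.1 ≤ v.1 →
        ∀ f ∈ (P u).1.map (gradedPiece k ξ₀ u.1).subtype,
          (monomial (v.1 - u.1) (1 : k) : MvPolynomial (Fin n) k) • f ∈
            (P v).1.map (gradedPiece k ξ₀ v.1).subtype} ∧
    ∃ S : Set (MvPolynomial (Σ v : {v // v ∈ ξ₁}, PluckerIndex ξ₀ ξ₁ v) k),
      (∀ p ∈ S, IsMultihomogeneous p) ∧
      ∀ (K : Type u) [Field K] [Algebra k K],
        Function.Injective (pluckerMap K ξ₀ ξ₁) ∧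
        Set.range (relationFamilyToGrassmann K ξ₀ ξ₁) =
          pluckerMap K ξ₀ ξ₁ ⁻¹' multiprojectiveZeroLocus S K ∧
        Set.range (pluckerMap K ξ₀ ξ₁ ∘ relationFamilyToGrassmann K ξ₀ ξ₁) =
          multiprojectiveZeroLocus S K := by
  refine ⟨relationFamilyToGrassmann_injective k ξ₀ ξ₁, range_relationFamilyToGrassmann k ξ₀ ξ₁,
    relationFamilyEquations k ξ₀ ξ₁,
    isMultihomogeneous_of_mem_relationFamilyEquations k ξ₀ ξ₁, ?_⟩
  intro K _ _
  have h : Set.range (relationFamilyToGrassmann K ξ₀ ξ₁) = pluckerMap K ξ₀ ξ₁ ⁻¹'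
      multiprojectiveZeroLocus (relationFamilyEquations k ξ₀ ξ₁) K :=
    Set.ext fun P => (pluckerMap_mem_zeroLocus_iff k ξ₀ ξ₁ K P).symm
  refine ⟨pluckerMap_injective ξ₀ ξ₁ K, h, ?_⟩
  -- The determinantal equations in `S` force every zero to be a Plücker point, so nothing is lost
  -- by pulling back and pushing forward.
  rw [Set.range_comp, h, Set.image_preimage_eq_of_subset
    (zeroLocus_subset_range_pluckerMap k ξ₀ ξ₁ K)]
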